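/- Let $\Omega\subset\mathbb{R}^2$ be a bounded Lipschitz domain with a strictly convex corner at $\mathbf 0\in\partial\Omega$: there are $h>0$ and angles $-\pi<\theta_m<\theta_M<\pi$ with $0<\theta_M-\theta_m<\pi$ such that $S_h:=\Omega\cap B_h=\{r(\cos\theta,\sin\theta): 0<r<h,\ \theta_m<\theta<\theta_M\}$, where $B_h$ is the open disk of radius $h$ about $\mathbf 0$. Let $\Gamma\subseteq\partial\Omega$ be relatively open in $\partial\Omega$ and contain the two sides $\{r(\cos\theta,\sin\theta):0\le r<h\}$, $\theta\in\{\theta_m,\theta_M\}$, of the corner. Let $\lambda,\mu,\rho_e,\rho_b,\kappa$ be real constants with $2\lambda+2\mu>0$, $\mu\neq 0$, $\rho_e,\rho_b,\kappa>0$, and let $\omega>0$. Write $\nabla\mathbf u=(\partial_j u_i)_{i,j}$, $\nabla^s\mathbf u=\tfrac12(\nabla\mathbf u+\nabla\mathbf u^{t})$, and, with $\nu$ the exterior unit normal, $T_\nu\mathbf u=\lambda(\nabla\cdot\mathbf u)\nu+2\mu(\nabla^s\mathbf u)\nu$. Let $(v,\mathbf u)\in H^1(\Omega)\times H^1(\Omega)^2$,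 real- or complex-valued and not identically zero, be a pair of acoustoelastic transmission eigenfunctions, that is, $$\begin{cases}\mu\Delta\mathbf u+(\lambda+\mu)\nabla\nabla\cdot\mathbf u+\omega^2\rho_e\mathbf u=\mathbf 0 & \text{in }\Omega,\\ \nabla\cdot(\rho_b^{-1}\nabla v)+\omega^2\kappa^{-1}v=0 & \text{in }\Omega,\\ \mathbf u\cdot\nu-\frac{1}{\rho_b\omega^2}\nabla v\cdot\nu=0 & \text{on }\Gamma,\\ T_\nu\mathbf u+v\nu=\mathbf 0 & \text{on }\Gamma,\end{cases}$$ where the equations hold in the sense of distributions and the boundary conditions in the sense of normal traces in $H^{-1/2}$ (defined by Green's formula and tested with smooth functions vanishing near $\partial\Omega\setminus\Gamma$). Assume that $\mathbf u\in C^{1,\alpha_1}(\overline{S_h})^2$ and $v\in C^{\alpha_2}(\overline{S_h})$ for some $\alpha_1,\alpha_2\in(0,1)$. Then: (a) $\nabla^s\mathbf u(\mathbf 0)=\partial_1u_1(\mathbf 0)\,I$, where $I$ is the identity matrix; (b) $v(\mathbf 0)=-2(\lambda+\mu)\,\partial_1u_1(\mathbf 0)$; (c) if $\partial_1u_1(\mathbf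 0)=0$, then $v(\mathbf 0)=0$; (d) if $\partial_1u_1(\mathbf 0)=0$ and $\partial_2u_1(\mathbf 0)=0$, then $\nabla\mathbf u(\mathbf 0)=\mathbf 0$. -/

import Mathlib

open MeasureTheory Set
open scoped NNReal ContDiff

/-- The Euclidean plane `ℝ²`. -/
abbrev Plane : Type := EuclideanSpace ℝ (Fin 2)

/-- A bounded Lipschitz domain: open, connected (in particular non-empty), bounded, and near each
boundary point equal, in suitable Cartesian coordinates, to the region above the graph of a
Lipschitz function. -/
structure IsBoundedLipschitzDomain (Ω : Set Plane) : Prop where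
  isOpen : IsOpen Ω
  isConnected : IsConnected Ω
  isBounded : Bornology.IsBounded Ω
  lipschitz : ∀ x ∈ frontier Ω, ∃ (R : Plane ≃ₗᵢ[ℝ] Plane) (g : ℝ → ℝ) (K : ℝ≥0) (r : ℝ),
    LipschitzWith K g ∧ 0 < r ∧
      ∀ y ∈ Metric.ball x r, (y ∈ Ω ↔ g ((R y) 0) < (R y) 1)

/-- The open sector with vertex `0` between the polar angles `θm` and `θM`. -/
def openSector (θm θM : ℝ) : Set Plane :=
  {x | ∃ r θ : ℝ, 0 < r ∧ θm < θ ∧ θ < θM ∧ x = !₂[r * Real.cos θ, r * Real.sin θ]}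

/-- The closed half-line issuing from `0` with polar angle `θ`. -/
def halfLine (θ : ℝ) : Set Plane :=
  {x | ∃ r : ℝ, 0 ≤ r ∧ x = !₂[r * Real.cos θ, r * Real.sin θ]}

/-- `Ω` has a strictly convex corner at `0` which, inside the disk `B_h`, is bounded by the
half-lines with polar angles `θm` and `θM`. -/
structure HasStrictlyConvexCorner (Ω : Set Plane) (θm θM h : ℝ) : Prop where
  neg_pi_lt : -Real.pi < θm
  lt : θm < θM
  lt_pi : θM < Real.pi
  opening_lt_pi : θM - θm < Real.pi
  h_pos : 0 < h
  inter_ball : Ω ∩ Metric.ball 0 h = openSector θm θM ∩ Metric.ball 0 h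

/-- The part `S_h = Ω ∩ B_h` of the domain near the corner. -/
def cornerRegion (Ω : Set Plane) (h : ℝ) : Set Plane := Ω ∩ Metric.ball 0 h

/-- Smooth compactly supported real functions on the plane. -/
def IsTestFunction (φ : Plane → ℝ) : Prop := ContDiff ℝ ∞ φ ∧ HasCompactSupport φ

/-- The partial derivative `∂_j φ` of a differentiable function on the plane. -/
noncomputable def partialDeriv (j : Fin 2) (φ : Plane → ℝ) (x : Plane) : ℝ :=
  fderiv ℝ φ x (EuclideanSpace.single j 1)

section Sobolev

variable {𝕜 : Type*} [RCLike 𝕜]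

/-- `w ∈ H¹(Ω)` with weak gradient `G = (∂₁w, ∂₂w)`. -/
structure IsH1WithGradient (Ω : Set Plane) (w : Plane → 𝕜) (G : Plane → Fin 2 → 𝕜) : Prop where
  memLp : MemLp w 2 (volume.restrict Ω)
  memLp_grad : ∀ j, MemLp (fun x => G x j) 2 (volume.restrict Ω)
  weak_grad : ∀ φ : Plane → ℝ, IsTestFunction φ → tsupport φ ⊆ Ω → ∀ j,
    ∫ x in Ω, partialDeriv j φ x • w x = -∫ x in Ω, φ x • G x j

/-- `w ∈ L²(Ω)²` has the weak divergence `f ∈ L²(Ω)`, that is, `w ∈ H(div; Ω)` and `∇ · w = f`. -/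
structure HasWeakDiv (Ω : Set Plane) (w : Plane → Fin 2 → 𝕜) (f : Plane → 𝕜) : Prop where
  memLp : ∀ j, MemLp (fun x => w x j) 2 (volume.restrict Ω)
  memLp_div : MemLp f 2 (volume.restrict Ω)
  weak_div : ∀ φ : Plane → ℝ, IsTestFunction φ → tsupport φ ⊆ Ω →
    ∫ x in Ω, ∑ j, partialDeriv j φ x • w x j = -∫ x in Ω, φ x • f x

/-- The pairing `⟨w · ν, φ⟩` over `∂Ω` of the normal trace of a field `w ∈ H(div; Ω)` with weak
divergence `f`, where `ν` is the exterior unit normal. The normal trace lies in `H^{-1/2}(∂Ω)` and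
is defined, as usual, by Green's formula; for smooth fields this is the integral of `(w · ν) φ`
over `∂Ω`. -/
noncomputable def normalTracePairing (Ω : Set Plane) (w : Plane → Fin 2 → 𝕜) (f : Plane → 𝕜)
    (φ : Plane → ℝ) : 𝕜 :=
  ∫ x in Ω, ((∑ j, partialDeriv j φ x • w x j) + φ x • f x)

/-- `w ∈ H(div; Ω)` and `w · ν = 0` on the part `Γ` of `∂Ω`, in the sense of normal traces: the
normal trace annihilates all test functions which vanish near `∂Ω \ Γ`. -/
def NormalTraceVanishesOn (Ω Γ : Set Plane) (w : Plane → Fin 2 → 𝕜) : Prop :=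
  ∃ f : Plane → 𝕜, HasWeakDiv Ω w f ∧
    ∀ φ : Plane → ℝ, IsTestFunction φ → tsupport φ ∩ frontier Ω ⊆ Γ →
      normalTracePairing Ω w f φ = 0

/-- The strain `∇ˢu = (∇u + ∇uᵗ) / 2` as a function of the matrix `∇u = (∂_j u_i)`. -/
noncomputable def strain (A : Matrix (Fin 2) (Fin 2) 𝕜) : Matrix (Fin 2) (Fin 2) 𝕜 :=
  (1 / 2 : ℝ) • (A + A.transpose)

/-- The stress `λ (∇ · u) I + 2 μ ∇ˢu` as a function of the matrix `∇u`; the traction `T_ν u` is the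
stress applied to the exterior normal `ν`. -/
noncomputable def stress (lam mu : ℝ) (A : Matrix (Fin 2) (Fin 2) 𝕜) :
    Matrix (Fin 2) (Fin 2) 𝕜 :=
  (lam • A.trace) • (1 : Matrix (Fin 2) (Fin 2) 𝕜) + (2 * mu) • strain A

/-- `(v, u) ∈ H¹(Ω) × H¹(Ω)²` is a pair of acoustoelastic transmission eigenfunctions associated
with `ω`, with constant coefficients and with transmission conditions on `Γ ⊆ ∂Ω`. -/
structure IsTransmissionEigenpair (Ω Γ : Set Plane) (lam mu rhoe rhob kappa omega : ℝ)
    (v : Plane → 𝕜) (u : Fin 2 → Plane → 𝕜) : Prop where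
  /-- `(v, u)` does not vanish identically. -/
  nontrivial : ¬ ((∀ᵐ x ∂(volume.restrict Ω), v x = 0) ∧
    ∀ i, ∀ᵐ x ∂(volume.restrict Ω), u i x = 0)
  /-- There are weak gradients `Dv` of `v` and `Du = (∂_j u_i)` of `u` with the following
  properties. -/
  weak_solution : ∃ (Dv : Plane → Fin 2 → 𝕜) (Du : Plane → Matrix (Fin 2) (Fin 2) 𝕜),
    IsH1WithGradient Ω v Dv ∧
    (∀ i, IsH1WithGradient Ω (u i) (fun x => Du x i)) ∧
    -- `μ Δu + (λ + μ) ∇(∇ · u) + ω² ρ_e u = 0` in `Ω`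
    (∀ φ : Plane → ℝ, IsTestFunction φ → tsupport φ ⊆ Ω → ∀ i,
      ∫ x in Ω, (mu • (∑ j, partialDeriv j φ x • Du x i j)
          + (lam + mu) • (partialDeriv i φ x • (Du x).trace))
        = ∫ x in Ω, (omega ^ 2 * rhoe) • (φ x • u i x)) ∧
    -- `∇ · (ρ_b⁻¹ ∇v) + ω² κ⁻¹ v = 0` in `Ω`
    (∀ φ : Plane → ℝ, IsTestFunction φ → tsupport φ ⊆ Ω →
      ∫ x in Ω, ∑ j, partialDeriv j φ x • (rhob⁻¹ • Dv x j)
        = ∫ x in Ω, (omega ^ 2 * kappa⁻¹) • (φ x • v x)) ∧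
    -- `u · ν - (ρ_b ω²)⁻¹ ∇v · ν = 0` on `Γ`
    NormalTraceVanishesOn Ω Γ (fun x j => u j x - (1 / (rhob * omega ^ 2)) • Dv x j) ∧
    -- `T_ν u + v ν = 0` on `Γ`, componentwise
    (∀ i, NormalTraceVanishesOn Ω Γ
      (fun x j => stress lam mu (Du x) i j + if i = j then v x else 0))

/-- `w ∈ C^{1,α}` on the closure of the open set `S`: `w` is continuously differentiable up to the
boundary and its derivative is Hölder continuous with exponent `α`. (Used for bounded convex `S`, so
that derivatives within the closure are unique.) -/
def IsC1Holder (S : Set Plane) (α : ℝ≥0) (w : Plane → 𝕜) : Prop :=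
  ContDiffOn ℝ 1 w (closure S) ∧
    ∃ C : ℝ≥0, HolderOnWith C α (fderivWithin ℝ w (closure S)) (closure S)

/-- The matrix `∇u(x) = (∂_j u_i(x))` of classical derivatives, taken within the closure of `S`. -/
noncomputable def cornerGradient (S : Set Plane) (u : Fin 2 → Plane → 𝕜) (x : Plane) :
    Matrix (Fin 2) (Fin 2) 𝕜 :=
  Matrix.of fun i j => fderivWithin ℝ (u i) (closure S) x (EuclideanSpace.single j 1)

end Sobolev

open Filter Topology
open scoped Pointwise

/-! ### Weak gradients versus classical gradients. -/

section WeakGradient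

variable {𝕜 : Type*} [RCLike 𝕜]

/-! The proof is a blow-up at the vertex. Each row `w` of the stress plus `v` times the identity
lies in `H(div)`, has zero normal trace near `0` on `Γ`, and has a limit `w₀` at `0`, because there
the weak gradient of `u` is the classical one, continuous up to the corner
(`IsH1WithGradient.ae_eq_fderiv`). Put `ψ(x/ε)` into Green's formula. The term with `∇ψ` is `ε`
times `(∫_K ∇ψ) · w₀`, up to `o(ε)`, where `K` is the infinite sector. The term with the divergence
`f` is `o(ε)`, since `ψ(·/ε)` has `L²` norm of order `ε` and the `L²` norm of `f` on a ball of
radius `εR` tends to zero. Hence `(∫_K ∇ψ) · w₀ = 0` for every test function `ψ`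
(`NormalTraceVanishesOn.sum_setIntegral_partialDeriv_smul_eq_zero`).

This says that `w₀` is orthogonal to the normals of both sides of `K`. The sides are not parallel,
so `w₀ = 0` (`eq_zero_of_setIntegral_partialDeriv_quadrant`). Thus the stress at the vertex is the
pressure `-v(0) I`, and the rest is algebra of 2×2 matrices
(`strain_eq_smul_one_of_stress_add_eq_zero`). -/

lemma IsTestFunction.continuous_partialDeriv {φ : Plane → ℝ} (hφ : IsTestFunction φ) (j : Fin 2) :
    Continuous (partialDeriv j φ) :=
  (hφ.1.continuous_fderiv (by simp)).clm_apply continuous_const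

lemma tsupport_partialDeriv_subset (φ : Plane → ℝ) (j : Fin 2) :
    tsupport (partialDeriv j φ) ⊆ tsupport φ :=
  tsupport_fderiv_apply_subset ℝ _

lemma IsTestFunction.hasCompactSupport_partialDeriv {φ : Plane → ℝ} (hφ : IsTestFunction φ)
    (j : Fin 2) : HasCompactSupport (partialDeriv j φ) :=
  hφ.2.mono' ((subset_tsupport _).trans (tsupport_partialDeriv_subset φ j))

/-- A continuous function supported in an open set times a function continuous on this set. -/
lemma continuous_smul_of_tsupport_subset {S : Set Plane} (hS : IsOpen S) {φ : Plane → ℝ}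
    (hφ : Continuous φ) (hsupp : tsupport φ ⊆ S) {w : Plane → 𝕜} (hw : ContinuousOn w S) :
    Continuous fun x => φ x • w x := by
  refine continuous_of_tsupport fun x hx => ?_
  have hxS : x ∈ S := hsupp (closure_mono (fun y hy => by
    contrapose! hy
    simp [Function.notMem_support.1 hy]) hx)
  exact hφ.continuousAt.smul (hw.continuousAt (hS.mem_nhds hxS))

/-- A weak gradient agrees almost everywhere with the classical one where the latter is
continuous. -/
lemma IsH1WithGradient.ae_eq_fderiv {Ω S : Set Plane} (hS : IsOpen S)
    (hSΩ : S ⊆ Ω) {w : Plane → 𝕜} {G : Plane → Fin 2 → 𝕜} (h : IsH1WithGradient Ω w G)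
    (hw : ContDiffOn ℝ 1 w S) (j : Fin 2) :
    ∀ᵐ x : Plane, x ∈ S → G x j = fderiv ℝ w x (EuclideanSpace.single j 1) := by
  set d : Plane → 𝕜 := fun x => fderiv ℝ w x (EuclideanSpace.single j 1) with hd
  have hdc : ContinuousOn d S :=
    (hw.continuousOn_fderiv_of_isOpen hS le_rfl).clm_apply continuousOn_const
  have hGS : LocallyIntegrable (fun x => G x j) (volume.restrict S) :=
    ((h.memLp_grad j).mono_measure (Measure.restrict_mono_set _ hSΩ)).locallyIntegrable
      (by norm_num)
  have hGint : ∀ φ : Plane → ℝ, IsTestFunction φ → tsupport φ ⊆ S →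
      Integrable (fun x => φ x • G x j) := by
    intro φ hφ hsupp
    have h1 : Integrable (fun x => φ x • G x j) (volume.restrict S) :=
      hGS.integrable_smul_left_of_hasCompactSupport hφ.1.continuous hφ.2
    refine (integrableOn_iff_integrable_of_support_subset fun x hx => hsupp (subset_tsupport _ ?_)).1 h1
    intro h0
    simp [h0] at hx
  have key : ∀ᵐ x : Plane, x ∈ S → G x j - d x = 0 := by
    refine hS.ae_eq_zero_of_integral_contDiff_smul_eq_zero ?_ ?_
    · exact (locallyIntegrableOn_of_locallyIntegrable_restrict hGS).sub
        (hdc.locallyIntegrableOn hS.measurableSet)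
    · intro φ hφ1 hφ2 hsupp
      have hφ : IsTestFunction φ := ⟨hφ1, hφ2⟩
      have hweak := h.weak_grad φ hφ (hsupp.trans hSΩ) j
      -- Both integrands are supported in `S`, so the weak identity on `Ω` becomes one on the whole
      -- plane, comparable with classical integration by parts.
      rw [setIntegral_eq_integral_of_forall_compl_eq_zero,
        setIntegral_eq_integral_of_forall_compl_eq_zero] at hweak
      rotate_left
      · intro x hx
        rw [image_eq_zero_of_notMem_tsupport (fun hx' => hx (hSΩ (hsupp hx'))), zero_smul]
      · intro x hx
        rw [image_eq_zero_of_notMem_tsupport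
          (fun hx' => hx (hSΩ (hsupp (tsupport_partialDeriv_subset φ j hx')))), zero_smul]
      have hsupp' := (tsupport_partialDeriv_subset φ j).trans hsupp
      have I1 : Integrable (fun x => partialDeriv j φ x • w x) :=
        (continuous_smul_of_tsupport_subset hS (hφ.continuous_partialDeriv j) hsupp'
          hw.continuousOn).integrable_of_hasCompactSupport
          ((hφ.hasCompactSupport_partialDeriv j).smul_right)
      have I2 : Integrable (fun x => φ x • d x) :=
        (continuous_smul_of_tsupport_subset hS hφ1.continuous hsupp
          hdc).integrable_of_hasCompactSupport hφ2.smul_right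
      have I3 : Integrable (fun x => φ x • w x) :=
        (continuous_smul_of_tsupport_subset hS hφ1.continuous hsupp
          hw.continuousOn).integrable_of_hasCompactSupport hφ2.smul_right
      have hparts : ∫ x, φ x • d x = -∫ x, partialDeriv j φ x • w x :=
        integral_smul_fderiv_eq_neg_fderiv_smul_of_integrable I1 I2 I3
          (fun x _ => (hφ1.differentiable (by simp)) x)
          (fun x hx => (hw.differentiableOn one_ne_zero).differentiableAt
            (hS.mem_nhds (hsupp hx)))
      simp_rw [smul_sub]
      rw [integral_sub (hGint φ hφ hsupp) I2, hparts, hweak]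
      simp
  filter_upwards [key] with x hx hxS using sub_eq_zero.1 (hx hxS)

end WeakGradient

/-! ### Oblique coordinates on a sector and constant fields. -/

section Sector

/-- A convex sector is a quadrant in the coordinates along its sides. -/
lemma exists_openSector_eq_preimage_quadrant {θm θM : ℝ} (hlt : θm < θM)
    (hopen : θM - θm < Real.pi) :
    ∃ L : Plane ≃L[ℝ] ℝ × ℝ, openSector θm θM = L ⁻¹' (Ioi 0 ×ˢ Ioi 0) := by
  have hs : 0 < Real.sin (θM - θm) := Real.sin_pos_of_pos_of_lt_pi (by linarith) hopen
  have hs' := hs.ne'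
  set s := Real.sin (θM - θm) with hsdef
  have hs2 : s = Real.sin θM * Real.cos θm - Real.cos θM * Real.sin θm := Real.sin_sub _ _
  -- Cramer's rule for the basis of unit vectors along the two sides, whose determinant is `s`.
  let L : Plane ≃ₗ[ℝ] ℝ × ℝ :=
    { toFun := fun x => ((x 0 * Real.sin θM - x 1 * Real.cos θM) / s,
        (x 1 * Real.cos θm - x 0 * Real.sin θm) / s)
      invFun := fun p => !₂[p.1 * Real.cos θm + p.2 * Real.cos θM,
        p.1 * Real.sin θm + p.2 * Real.sin θM]
      map_add' := fun x y => by
        ext <;> simp <;> ring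
      map_smul' := fun c x => by
        ext <;> simp <;> ring
      left_inv := fun x => by
        ext i
        fin_cases i <;> simp <;> field_simp <;> rw [hs2] <;> ring
      right_inv := fun p => by
        ext <;> simp <;> field_simp <;> rw [hs2] <;> ring }
  refine ⟨L.toContinuousLinearEquiv, ?_⟩
  ext x
  have hL : L.toContinuousLinearEquiv x = ((x 0 * Real.sin θM - x 1 * Real.cos θM) / s,
        (x 1 * Real.cos θm - x 0 * Real.sin θm) / s) := rfl
  simp only [mem_preimage, mem_prod, mem_Ioi, hL, div_pos_iff_of_pos_right hs]
  constructor
  · rintro ⟨r, θ, hr, h1, h2, rfl⟩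
    have p1 : 0 < r * Real.sin (θM - θ) :=
      mul_pos hr (Real.sin_pos_of_pos_of_lt_pi (by linarith) (by linarith))
    have p2 : 0 < r * Real.sin (θ - θm) :=
      mul_pos hr (Real.sin_pos_of_pos_of_lt_pi (by linarith) (by linarith))
    rw [Real.sin_sub] at p1 p2
    simp only [Matrix.cons_val_zero, Matrix.cons_val_one]
    constructor <;> linarith
  · rintro ⟨h1, h2⟩
    -- rotate by `-θm` and use the argument of the resulting complex number
    set z : ℂ := ⟨x 0 * Real.cos θm + x 1 * Real.sin θm,
      x 1 * Real.cos θm - x 0 * Real.sin θm⟩ with hz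
    have hre : z.re = x 0 * Real.cos θm + x 1 * Real.sin θm := rfl
    have him : z.im = x 1 * Real.cos θm - x 0 * Real.sin θm := rfl
    have hzim : 0 < z.im := h2
    have hz0 : z ≠ 0 := fun h => by simp [h] at hzim
    have hnorm : 0 < ‖z‖ := norm_pos_iff.2 hz0
    have hc : ‖z‖ * Real.cos z.arg = z.re := Complex.norm_mul_cos_arg z
    have hsn : ‖z‖ * Real.sin z.arg = z.im := Complex.norm_mul_sin_arg z
    have harg0 : 0 ≤ z.arg := Complex.arg_nonneg_iff.2 hzim.le
    have harg1 : z.arg ≠ 0 := fun h => by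
      rw [h, Real.sin_zero, mul_zero] at hsn
      exact hzim.ne hsn
    have hcs := Real.sin_sq_add_cos_sq θm
    -- Otherwise `z.arg - (θM - θm)` lies in `[0, π]` and has nonnegative sine; but `‖z‖` times this
    -- sine is `-s` times the first oblique coordinate, which is negative by `h1`.
    have hargM : z.arg < θM - θm := by
      by_contra! hge
      have hle : ‖z‖ * Real.sin (z.arg - (θM - θm)) ≥ 0 :=
        mul_nonneg hnorm.le (Real.sin_nonneg_of_nonneg_of_le_pi (by linarith)
          (by linarith [Complex.arg_le_pi z]))
      have : ‖z‖ * Real.sin (z.arg - (θM - θm))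
          = -(x 0 * Real.sin θM - x 1 * Real.cos θM) := by
        rw [Real.sin_sub, Real.sin_sub, Real.cos_sub]
        linear_combination (Real.cos θM * Real.cos θm + Real.sin θM * Real.sin θm) * hsn
          - (Real.sin θM * Real.cos θm - Real.cos θM * Real.sin θm) * hc
          + (Real.cos θM * Real.cos θm + Real.sin θM * Real.sin θm) * him
          - (Real.sin θM * Real.cos θm - Real.cos θM * Real.sin θm) * hre
          + (x 1 * Real.cos θM - x 0 * Real.sin θM) * hcs
      linarith
    refine ⟨‖z‖, θm + z.arg, hnorm, ?_, by linarith, ?_⟩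
    · have := lt_of_le_of_ne harg0 (Ne.symm harg1)
      linarith
    · ext i
      fin_cases i
      · change x 0 = ‖z‖ * Real.cos (θm + z.arg)
        rw [Real.cos_add]
        linear_combination -Real.cos θm * hc + Real.sin θm * hsn - Real.cos θm * hre
          + Real.sin θm * him - x 0 * hcs
      · change x 1 = ‖z‖ * Real.sin (θm + z.arg)
        rw [Real.sin_add]
        linear_combination -Real.sin θm * hc - Real.cos θm * hsn - Real.sin θm * hre
          - Real.cos θm * him - x 1 * hcs

variable {𝕜 : Type*} [RCLike 𝕜]

/-- Integrals over the preimage of a set under a linear isomorphism, up to the Jacobian. -/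
lemma exists_setIntegral_comp_eq_mul (L : Plane ≃L[ℝ] ℝ × ℝ) :
    ∃ c : ℝ, 0 < c ∧ ∀ (F : ℝ × ℝ → ℝ) (Q : Set (ℝ × ℝ)),
      ∫ x in L ⁻¹' Q, F (L x) = c * ∫ p in Q, F p := by
  obtain ⟨c, hc, hmap⟩ : ∃ c : ℝ≥0, 0 < c ∧
      Measure.map L (volume : Measure Plane) = c • (volume : Measure (ℝ × ℝ)) :=
    ⟨_, Measure.addHaarScalarFactor_pos_of_isAddHaarMeasure _ _,
      Measure.isAddLeftInvariant_eq_smul _ _⟩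
  refine ⟨c, hc, fun F Q => ?_⟩
  have he : MeasurableEmbedding L := L.toHomeomorph.measurableEmbedding
  rw [← he.setIntegral_map, hmap, Measure.restrict_smul, integral_smul_nnreal_measure]
  simp [NNReal.smul_def]

/-- The product of two functions of one variable each, in linear coordinates on the plane. -/
lemma isTestFunction_mul_comp (L : Plane ≃L[ℝ] ℝ × ℝ) {η ζ : ℝ → ℝ} (hη : ContDiff ℝ ∞ η)
    (hηc : HasCompactSupport η) (hζ : ContDiff ℝ ∞ ζ) (hζc : HasCompactSupport ζ) :
    IsTestFunction fun x => η (L x).1 * ζ (L x).2 := by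
  constructor
  · exact (hη.comp (contDiff_fst.comp L.contDiff)).mul (hζ.comp (contDiff_snd.comp L.contDiff))
  · have : HasCompactSupport fun p : ℝ × ℝ => η p.1 * ζ p.2 := by
      refine HasCompactSupport.intro (hηc.prod hζc) fun p hp => ?_
      rw [mem_prod, not_and_or] at hp
      rcases hp with hp | hp <;> simp [image_eq_zero_of_notMem_tsupport hp]
    exact this.comp_homeomorph L.toHomeomorph

lemma partialDeriv_mul_comp (L : Plane ≃L[ℝ] ℝ × ℝ) {η ζ : ℝ → ℝ} (hη : Differentiable ℝ η)
    (hζ : Differentiable ℝ ζ) (j : Fin 2) (x : Plane) :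
    partialDeriv j (fun x => η (L x).1 * ζ (L x).2) x
      = (L (EuclideanSpace.single j 1)).1 * (deriv η (L x).1 * ζ (L x).2)
        + (L (EuclideanSpace.single j 1)).2 * (η (L x).1 * deriv ζ (L x).2) := by
  have hL : HasFDerivAt (fun x => L x) (L : Plane →L[ℝ] ℝ × ℝ) x := L.hasFDerivAt
  have h1 := (hη (L x).1).hasDerivAt.comp_hasFDerivAt x hL.fst
  have h2 := (hζ (L x).2).hasDerivAt.comp_hasFDerivAt x hL.snd
  have h3 : HasFDerivAt (fun x => η (L x).1 * ζ (L x).2) _ x := h1.mul h2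
  rw [partialDeriv, h3.fderiv]
  simp
  ring

/-- By Fubini in the oblique coordinates, the differentiated factor integrates over the half-line to
minus its value at `0`. What remains is one integral along each side. The constant `c` is the
Jacobian, common to all `η`, `ζ` and `j`. -/
lemma setIntegral_partialDeriv_mul_comp (L : Plane ≃L[ℝ] ℝ × ℝ) :
    ∃ c : ℝ, 0 < c ∧ ∀ η ζ : ℝ → ℝ, ContDiff ℝ ∞ η → HasCompactSupport η →
      ContDiff ℝ ∞ ζ → HasCompactSupport ζ → ∀ j : Fin 2,
      ∫ x in L ⁻¹' (Ioi 0 ×ˢ Ioi 0), partialDeriv j (fun x => η (L x).1 * ζ (L x).2) x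
        = -c * ((L (EuclideanSpace.single j 1)).1 * (η 0 * ∫ t in Ioi 0, ζ t)
          + (L (EuclideanSpace.single j 1)).2 * (ζ 0 * ∫ t in Ioi 0, η t)) := by
  obtain ⟨c, hc, hint⟩ := exists_setIntegral_comp_eq_mul L
  refine ⟨c, hc, fun η ζ hη hηc hζ hζc j => ?_⟩
  have hη1 : ContDiff ℝ 1 η := hη.of_le (by simp)
  have hζ1 : ContDiff ℝ 1 ζ := hζ.of_le (by simp)
  simp_rw [partialDeriv_mul_comp L (hη.differentiable (by simp)) (hζ.differentiable (by simp))]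
  rw [hint (fun p => (L (EuclideanSpace.single j 1)).1 * (deriv η p.1 * ζ p.2)
        + (L (EuclideanSpace.single j 1)).2 * (η p.1 * deriv ζ p.2)), integral_add]
  · rw [integral_const_mul, integral_const_mul, Measure.volume_eq_prod,
      setIntegral_prod_mul, setIntegral_prod_mul, hηc.integral_Ioi_deriv_eq hη1,
      hζc.integral_Ioi_deriv_eq hζ1]
    ring
  all_goals
    refine Integrable.integrableOn (Integrable.const_mul ?_ _)
    rw [Measure.volume_eq_prod]
  · exact ((hη1.continuous_deriv le_rfl).integrable_of_hasCompactSupport hηc.deriv).mul_prod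
      (hζ.continuous.integrable_of_hasCompactSupport hζc)
  · exact (hη.continuous.integrable_of_hasCompactSupport hηc).mul_prod
      ((hζ1.continuous_deriv le_rfl).integrable_of_hasCompactSupport hζc.deriv)

/-- A constant field whose normal trace vanishes on both sides of a convex sector is zero. -/
lemma eq_zero_of_setIntegral_partialDeriv_quadrant (L : Plane ≃L[ℝ] ℝ × ℝ) (c : Fin 2 → 𝕜)
    (h : ∀ ψ : Plane → ℝ, IsTestFunction ψ →
      ∑ j, (∫ x in L ⁻¹' (Ioi 0 ×ˢ Ioi 0), partialDeriv j ψ x) • c j = 0) : c = 0 := by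
  obtain ⟨D, hD, hint⟩ := setIntegral_partialDeriv_mul_comp L
  -- These bumps isolate one side at a time: `b₀` is `1` at `0`, while `b₁`, centred at `2` with
  -- outer radius `2`, vanishes at `0` and keeps its whole positive integral on the half-line. The
  -- two products of `b₀` and `b₁` kill one oblique coordinate of `c` each.
  let b₀ : ContDiffBump (0 : ℝ) := ⟨1, 2, by norm_num, by norm_num⟩
  let b₁ : ContDiffBump (2 : ℝ) := ⟨1, 2, by norm_num, by norm_num⟩
  have hb₀ : b₀ 0 = 1 := b₀.one_of_mem_closedBall (by simp [b₀])
  have hb₁ : b₁ 0 = 0 := b₁.zero_of_le_dist (by simp [b₁])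
  have hI : 0 < ∫ t in Ioi (0 : ℝ), b₁ t := by
    rw [setIntegral_eq_integral_of_forall_compl_eq_zero]
    · exact b₁.integral_pos
    · intro t ht
      refine b₁.zero_of_le_dist ?_
      rw [mem_Ioi, not_lt] at ht
      rw [Real.dist_eq, abs_of_nonpos (by linarith)]
      simp only [b₁]
      linarith
  have e1 : ∑ j, (L (EuclideanSpace.single j 1)).1 • c j = 0 := by
    have := h _ (isTestFunction_mul_comp L b₀.contDiff b₀.hasCompactSupport b₁.contDiff
      b₁.hasCompactSupport)
    simp_rw [hint _ _ b₀.contDiff b₀.hasCompactSupport b₁.contDiff b₁.hasCompactSupport,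
      hb₀, hb₁, zero_mul, mul_zero, add_zero, one_mul, mul_comm _ (∫ t in Ioi (0 : ℝ), b₁ t),
      ← mul_assoc, mul_smul (_ * _), ← Finset.smul_sum] at this
    exact (smul_eq_zero.1 this).resolve_left (by simp [hD.ne', hI.ne'])
  have e2 : ∑ j, (L (EuclideanSpace.single j 1)).2 • c j = 0 := by
    have := h _ (isTestFunction_mul_comp L b₁.contDiff b₁.hasCompactSupport b₀.contDiff
      b₀.hasCompactSupport)
    simp_rw [hint _ _ b₁.contDiff b₁.hasCompactSupport b₀.contDiff b₀.hasCompactSupport,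
      hb₀, hb₁, zero_mul, mul_zero, zero_add, one_mul, mul_comm _ (∫ t in Ioi (0 : ℝ), b₁ t),
      ← mul_assoc, mul_smul (_ * _), ← Finset.smul_sum] at this
    exact (smul_eq_zero.1 this).resolve_left (by simp [hD.ne', hI.ne'])
  -- `L` acts on real vectors only, so its injectivity is applied to real functionals of `c`, in the
  -- end the real and imaginary parts.
  have key : ∀ ℓ : 𝕜 →L[ℝ] ℝ, ∀ j, ℓ (c j) = 0 := by
    intro ℓ
    have hL : L (∑ j, ℓ (c j) • EuclideanSpace.single j (1 : ℝ)) = 0 := by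
      have h1 := congrArg ℓ e1
      have h2 := congrArg ℓ e2
      simp only [Fin.sum_univ_two, map_add, map_smul, smul_eq_mul, map_zero] at h1 h2 ⊢
      ext
      · simp
        linarith
      · simp
        linarith
    rw [map_eq_zero_iff _ L.injective] at hL
    intro j
    have := congrArg (fun x : Plane => x j) hL
    fin_cases j <;> simpa [Fin.sum_univ_two] using this
  ext j
  exact RCLike.ext (by simpa using key RCLike.reCLM j) (by simpa using key RCLike.imCLM j)

end Sector

/-! ### Rescaling about the vertex. -/

section BlowUp

variable {𝕜 : Type*} [RCLike 𝕜]

lemma hasCompactSupport_comp_inv_smul {g : Plane → ℝ} (hg : HasCompactSupport g) {ε : ℝ}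
    (hε : 0 < ε) : HasCompactSupport fun x => g (ε⁻¹ • x) :=
  hg.comp_homeomorph (Homeomorph.smulOfNeZero ε⁻¹ (inv_ne_zero hε.ne'))

lemma tsupport_comp_inv_smul_subset {g : Plane → ℝ} {R : ℝ}
    (hR : tsupport g ⊆ Metric.ball 0 R) {ε : ℝ} (hε : 0 < ε) :
    tsupport (fun x => g (ε⁻¹ • x)) ⊆ Metric.ball 0 (ε * R) := by
  intro x hx
  have := hR (tsupport_comp_subset_preimage g (continuous_const_smul ε⁻¹) hx)
  rw [mem_ball_zero_iff, norm_smul, norm_inv, Real.norm_of_nonneg hε.le,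
    inv_mul_lt_iff₀ hε] at this
  rwa [mem_ball_zero_iff]

lemma eventually_tsupport_comp_inv_smul_subset {g : Plane → ℝ} (hg : HasCompactSupport g)
    {V : Set Plane} (hV : V ∈ 𝓝 0) :
    ∀ᶠ ε : ℝ in 𝓝[>] 0, tsupport (fun x => g (ε⁻¹ • x)) ⊆ V := by
  obtain ⟨R, hR⟩ := hg.isBounded.subset_ball (0 : Plane)
  obtain ⟨r, hr, hrV⟩ := Metric.mem_nhds_iff.1 hV
  have hlim : Tendsto (fun ε : ℝ => ε * R) (𝓝[>] 0) (𝓝 0) :=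
    tendsto_nhdsWithin_of_tendsto_nhds
      (by simpa using (continuous_mul_const R).tendsto (0 : ℝ))
  filter_upwards [self_mem_nhdsWithin, hlim.eventually_lt_const hr] with ε hε hεr
  exact (tsupport_comp_inv_smul_subset hR hε).trans ((Metric.ball_subset_ball hεr.le).trans hrV)

lemma IsTestFunction.comp_inv_smul {ψ : Plane → ℝ} (hψ : IsTestFunction ψ) {ε : ℝ} (hε : 0 < ε) :
    IsTestFunction fun x => ψ (ε⁻¹ • x) :=
  ⟨hψ.1.comp (contDiff_const_smul _), hasCompactSupport_comp_inv_smul hψ.2 hε⟩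

lemma partialDeriv_comp_smul (j : Fin 2) (ψ : Plane → ℝ) (a : ℝ) (x : Plane) :
    partialDeriv j (fun x => ψ (a • x)) x = a * partialDeriv j ψ (a • x) := by
  simp [partialDeriv, fderiv_comp_smul]

lemma integral_comp_inv_smul_plane (g : Plane → ℝ) {ε : ℝ} (hε : 0 < ε) :
    ∫ x, g (ε⁻¹ • x) = ε ^ 2 * ∫ x, g x := by
  rw [Measure.integral_comp_inv_smul_of_nonneg _ _ hε.le]
  simp

lemma setIntegral_comp_inv_smul_cone (g : Plane → ℝ) {K : Set Plane}
    (hK : ∀ (t : ℝ) (x : Plane), 0 < t → (t • x ∈ K ↔ x ∈ K)) {ε : ℝ} (hε : 0 < ε) :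
    ∫ x in K, g (ε⁻¹ • x) = ε ^ 2 * ∫ x in K, g x := by
  have hKε : ε⁻¹ • K = K := by
    ext x
    rw [mem_smul_set_iff_inv_smul_mem₀ (inv_ne_zero hε.ne'), inv_inv, hK ε x hε]
  rw [Measure.setIntegral_comp_smul_of_pos _ _ _ (inv_pos.2 hε), hKε]
  simp

/-- Concentration of a rescaled weight at the vertex of a cone, for a field which has a limit at
the vertex. -/
lemma tendsto_setIntegral_comp_inv_smul {K : Set Plane} (hKo : IsOpen K)
    (hK : ∀ (t : ℝ) (x : Plane), 0 < t → (t • x ∈ K ↔ x ∈ K)) {h : ℝ} (hh : 0 < h)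
    {g : Plane → ℝ} (hg : Continuous g) (hgc : HasCompactSupport g)
    {w W : Plane → 𝕜} {w₀ : 𝕜} (hw : LocallyIntegrable w (volume.restrict (K ∩ Metric.ball 0 h)))
    (hwW : ∀ᵐ x : Plane, x ∈ K ∩ Metric.ball 0 h → w x = W x)
    (hW : Tendsto W (𝓝[K ∩ Metric.ball 0 h] 0) (𝓝 w₀)) :
    Tendsto (fun ε : ℝ => (ε ^ 2)⁻¹ • ∫ x in K ∩ Metric.ball 0 h, g (ε⁻¹ • x) • w x)
      (𝓝[>] 0) (𝓝 ((∫ x in K, g x) • w₀)) := by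
  set S := K ∩ Metric.ball (0 : Plane) h with hS
  have hSm : MeasurableSet S := (hKo.inter Metric.isOpen_ball).measurableSet
  set C := ∫ x, |g x| with hC
  have hC0 : 0 ≤ C := integral_nonneg fun x => abs_nonneg _
  rw [Metric.tendsto_nhds]
  intro e he
  -- The `+ 1` allows `C = 0` and makes the final bound `e * (C / (C + 1))` strictly less than `e`.
  obtain ⟨r, hr, hWr⟩ := Metric.tendsto_nhdsWithin_nhds.1 hW (e / (C + 1)) (by positivity)
  filter_upwards [self_mem_nhdsWithin,
    eventually_tsupport_comp_inv_smul_subset hgc (Metric.ball_mem_nhds 0 hr),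
    eventually_tsupport_comp_inv_smul_subset hgc (Metric.ball_mem_nhds 0 hh)] with ε hε h1 h2
  have hε : 0 < ε := hε
  have hgε : Continuous fun x => g (ε⁻¹ • x) := hg.comp (continuous_const_smul _)
  have hgεc := hasCompactSupport_comp_inv_smul hgc hε
  have I1 : Integrable (fun x => g (ε⁻¹ • x) • w x) (volume.restrict S) :=
    hw.integrable_smul_left_of_hasCompactSupport hgε hgεc
  have I2 : Integrable (fun x => g (ε⁻¹ • x) • w₀) (volume.restrict S) :=
    ((hgε.integrable_of_hasCompactSupport hgεc).smul_const w₀).integrableOn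
  -- Once the rescaled support lies in the disk, truncating the cone changes nothing, and dilation
  -- invariance gives the exact factor `ε ^ 2`.
  have hcone : ∫ x in S, g (ε⁻¹ • x) = ε ^ 2 * ∫ x in K, g x := by
    rw [← setIntegral_comp_inv_smul_cone g hK hε]
    refine (setIntegral_eq_of_subset_of_forall_sdiff_eq_zero hKo.measurableSet inter_subset_left
      fun x hx => image_eq_zero_of_notMem_tsupport (f := fun x => g (ε⁻¹ • x)) fun hx' =>
        hx.2 ⟨hx.1, h2 hx'⟩).symm
  have hdiff : ∫ x in S, g (ε⁻¹ • x) • (w x - w₀)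
      = (∫ x in S, g (ε⁻¹ • x) • w x) - (ε ^ 2 * ∫ x in K, g x) • w₀ := by
    simp_rw [smul_sub]
    rw [integral_sub I1 I2, integral_smul_const, hcone]
  have hbound : ‖∫ x in S, g (ε⁻¹ • x) • (w x - w₀)‖ ≤ ε ^ 2 * C * (e / (C + 1)) := by
    have hI : Integrable (fun x => |g (ε⁻¹ • x)| * (e / (C + 1))) :=
      (hgε.integrable_of_hasCompactSupport hgεc).abs.mul_const _
    calc ‖∫ x in S, g (ε⁻¹ • x) • (w x - w₀)‖
        ≤ ∫ x in S, |g (ε⁻¹ • x)| * (e / (C + 1)) := by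
          refine norm_integral_le_of_norm_le hI.integrableOn ?_
          filter_upwards [ae_restrict_mem hSm, ae_restrict_of_ae hwW] with x hxS hx
          rw [norm_smul, Real.norm_eq_abs]
          by_cases hgx : g (ε⁻¹ • x) = 0
          · simp [hgx]
          · have hxr := h1 (subset_tsupport (fun x => g (ε⁻¹ • x)) hgx)
            have := hWr hxS (Metric.mem_ball.1 hxr)
            rw [dist_eq_norm] at this
            rw [hx hxS]
            gcongr
      _ ≤ ∫ x, |g (ε⁻¹ • x)| * (e / (C + 1)) :=
          setIntegral_le_integral hI (Eventually.of_forall fun x => by positivity)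
      _ = ε ^ 2 * C * (e / (C + 1)) := by
          rw [integral_mul_const, integral_comp_inv_smul_plane (fun x => |g x|) hε]
  have heq : (ε ^ 2)⁻¹ • (∫ x in S, g (ε⁻¹ • x) • w x) - (∫ x in K, g x) • w₀
      = (ε ^ 2)⁻¹ • ∫ x in S, g (ε⁻¹ • x) • (w x - w₀) := by
    rw [hdiff, smul_sub, smul_smul, inv_mul_cancel_left₀ (by positivity)]
  rw [dist_eq_norm, heq, norm_smul, norm_inv, Real.norm_of_nonneg (by positivity)]
  calc (ε ^ 2)⁻¹ * ‖∫ x in S, g (ε⁻¹ • x) • (w x - w₀)‖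
      ≤ (ε ^ 2)⁻¹ * (ε ^ 2 * C * (e / (C + 1))) := by gcongr
    _ = e * (C / (C + 1)) := by field_simp
    _ < e * 1 := by
        gcongr
        rw [div_lt_one (by positivity)]
        linarith
    _ = e := mul_one e

/-- Absolute continuity of the integral: the areas of the balls tend to zero, hence so do their
`μ`-measures. -/
lemma tendsto_setIntegral_ball_zero {μ : Measure Plane} (hμ : μ ≤ volume) {f : Plane → ℝ}
    (hf : Integrable f μ) (R : ℝ) :
    Tendsto (fun ε : ℝ => ∫ x in Metric.ball 0 (ε * R), f x ∂μ) (𝓝[>] 0) (𝓝 0) := by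
  have hvol : Tendsto (fun ε : ℝ => (volume : Measure Plane) (Metric.ball 0 (ε * R)))
      (𝓝[>] 0) (𝓝 0) := by
    have h0 : Tendsto (fun ε : ℝ => ENNReal.ofReal (ε * R) ^ 2 * ENNReal.ofReal Real.pi)
        (𝓝 0) (𝓝 (ENNReal.ofReal (0 * R) ^ 2 * ENNReal.ofReal Real.pi)) :=
      ENNReal.Tendsto.mul_const
        (((ENNReal.continuous_pow 2).comp
          (ENNReal.continuous_ofReal.comp (continuous_mul_const R))).tendsto 0)
        (Or.inr ENNReal.ofReal_ne_top)
    simp_rw [EuclideanSpace.volume_ball_fin_two]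
    exact tendsto_nhdsWithin_of_tendsto_nhds (by simpa using h0)
  exact hf.tendsto_setIntegral_nhds_zero (tendsto_of_tendsto_of_tendsto_of_le_of_le
    tendsto_const_nhds hvol (fun ε => zero_le) fun ε => hμ _)

/-- Young's inequality: the difference of the two sides is the square `(δ a - ε b)²` over `2 ε δ`.
-/
lemma mul_le_weighted_sq_add_sq (a b : ℝ) {ε δ : ℝ} (hε : 0 < ε) (hδ : 0 < δ) :
    a * b ≤ ε⁻¹ * (δ / 2) * a ^ 2 + ε / (2 * δ) * b ^ 2 := by
  have h1 : ε⁻¹ * (δ / 2) * a ^ 2 + ε / (2 * δ) * b ^ 2 - a * b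
      = (δ * a - ε * b) ^ 2 / (2 * ε * δ) := by
    field_simp
    ring
  have h2 : 0 ≤ (δ * a - ε * b) ^ 2 / (2 * ε * δ) := by positivity
  linarith

/-- Pointwise Young, integrated, plays the role of Cauchy–Schwarz. The free parameter `δ` is later
matched to the `L²` norm of `f` on the shrinking ball, which makes both terms of order `ε δ`. -/
lemma norm_setIntegral_comp_inv_smul_le {Ω : Set Plane} {f : Plane → 𝕜}
    (hf : Integrable (fun x => ‖f x‖ ^ 2) (volume.restrict Ω)) {g : Plane → ℝ}
    (hg : Continuous g) (hgc : HasCompactSupport g) {R : ℝ} (hR : tsupport g ⊆ Metric.ball 0 R)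
    {ε δ : ℝ} (hε : 0 < ε) (hδ : 0 < δ) :
    ‖∫ x in Ω, g (ε⁻¹ • x) • f x‖ ≤ ε⁻¹ * (δ / 2) * (ε ^ 2 * ∫ x, g x ^ 2)
      + ε / (2 * δ) * ∫ x in Metric.ball 0 (ε * R), ‖f x‖ ^ 2 ∂(volume.restrict Ω) := by
  have hgε : Continuous fun x => g (ε⁻¹ • x) := hg.comp (continuous_const_smul _)
  have hgεc := hasCompactSupport_comp_inv_smul hgc hε
  have hsq : HasCompactSupport fun x : Plane => g (ε⁻¹ • x) ^ 2 := by
    simp_rw [pow_two]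
    exact hgεc.mul_left
  have J1 : Integrable (fun x : Plane => g (ε⁻¹ • x) ^ 2) :=
    (hgε.pow 2).integrable_of_hasCompactSupport hsq
  have J1' : Integrable (fun x : Plane => ε⁻¹ * (δ / 2) * g (ε⁻¹ • x) ^ 2)
      (volume.restrict Ω) := (J1.const_mul _).integrableOn
  have J2 : Integrable (fun x => ε / (2 * δ) *
      (Metric.ball 0 (ε * R)).indicator (fun x => ‖f x‖ ^ 2) x) (volume.restrict Ω) :=
    (hf.indicator Metric.isOpen_ball.measurableSet).const_mul _
  have hpt : ∀ x, ‖g (ε⁻¹ • x) • f x‖ ≤ ε⁻¹ * (δ / 2) * g (ε⁻¹ • x) ^ 2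
      + ε / (2 * δ) * (Metric.ball 0 (ε * R)).indicator (fun x => ‖f x‖ ^ 2) x := by
    intro x
    by_cases hgx : g (ε⁻¹ • x) = 0
    · have : 0 ≤ (Metric.ball 0 (ε * R)).indicator (fun x => ‖f x‖ ^ 2) x :=
        indicator_nonneg (fun x _ => sq_nonneg _) x
      rw [hgx, zero_smul, norm_zero]
      positivity
    · have hxB : x ∈ Metric.ball 0 (ε * R) := tsupport_comp_inv_smul_subset hR hε
        (subset_tsupport (fun x => g (ε⁻¹ • x)) hgx)
      rw [indicator_of_mem hxB, norm_smul, Real.norm_eq_abs, ← sq_abs (g _)]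
      exact mul_le_weighted_sq_add_sq _ _ hε hδ
  refine (norm_integral_le_of_norm_le (J1'.add J2) (Eventually.of_forall hpt)).trans ?_
  simp only [Pi.add_apply]
  rw [integral_add J1' J2, integral_const_mul, integral_const_mul,
    integral_indicator Metric.isOpen_ball.measurableSet,
    ← integral_comp_inv_smul_plane (fun x => g x ^ 2) hε]
  exact add_le_add (mul_le_mul_of_nonneg_left (setIntegral_le_integral J1
    (Eventually.of_forall fun x => sq_nonneg _)) (by positivity)) le_rfl

/-- Square integrable functions do not concentrate at a point to first order. -/
lemma tendsto_inv_smul_setIntegral_comp_inv_smul {Ω : Set Plane} {f : Plane → 𝕜}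
    (hf : MemLp f 2 (volume.restrict Ω)) {g : Plane → ℝ} (hg : Continuous g)
    (hgc : HasCompactSupport g) :
    Tendsto (fun ε : ℝ => ε⁻¹ • ∫ x in Ω, g (ε⁻¹ • x) • f x) (𝓝[>] 0) (𝓝 0) := by
  obtain ⟨R, hR⟩ := hgc.isBounded.subset_ball (0 : Plane)
  have hf2 : Integrable (fun x => ‖f x‖ ^ 2) (volume.restrict Ω) :=
    hf.integrable_norm_pow (by norm_num)
  obtain ⟨F, hF⟩ : ∃ F : ℝ → ℝ, F = fun ε =>
    ∫ x in Metric.ball 0 (ε * R), ‖f x‖ ^ 2 ∂(volume.restrict Ω) := ⟨_, rfl⟩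
  have hFlim : Tendsto F (𝓝[>] 0) (𝓝 0) :=
    hF ▸ tendsto_setIntegral_ball_zero Measure.restrict_le_self hf2 R
  have hδlim : Tendsto (fun ε => (√(F ε) + ε) * (((∫ x, g x ^ 2) + 1) / 2)) (𝓝[>] 0) (𝓝 0) := by
    simpa using (hFlim.sqrt.add (tendsto_nhdsWithin_of_tendsto_nhds tendsto_id)).mul_const
      (((∫ x, g x ^ 2) + 1) / 2)
  refine squeeze_zero_norm' ?_ hδlim
  filter_upwards [self_mem_nhdsWithin] with ε hε
  have hε : 0 < ε := hε
  have hsqrt := Real.sqrt_nonneg (F ε)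
  -- The summand `ε` keeps `δ` positive even if `F ε = 0`; still `F ε ≤ δ ^ 2` and `δ` tends to
  -- zero.
  obtain ⟨δ, hδ⟩ : ∃ δ, δ = √(F ε) + ε := ⟨_, rfl⟩
  have hδ0 : 0 < δ := by linarith
  have hFδ : F ε ≤ δ ^ 2 := by
    rw [← Real.sqrt_le_left hδ0.le]
    linarith
  have hint := norm_setIntegral_comp_inv_smul_le hf2 hg hgc hR hε hδ0
  rw [show ∫ x in Metric.ball 0 (ε * R), ‖f x‖ ^ 2 ∂(volume.restrict Ω) = F ε by rw [hF]] at hint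
  rw [norm_smul, norm_inv, Real.norm_of_nonneg hε.le, ← hδ]
  generalize ∫ x, g x ^ 2 = C at hint ⊢
  calc ε⁻¹ * ‖∫ x in Ω, g (ε⁻¹ • x) • f x‖
      ≤ ε⁻¹ * (ε⁻¹ * (δ / 2) * (ε ^ 2 * C) + ε / (2 * δ) * δ ^ 2) := by
        refine mul_le_mul_of_nonneg_left (hint.trans ?_) (by positivity)
        gcongr
    _ = δ * ((C + 1) / 2) := by
        field_simp

/-- If the normal trace of a field vanishes near a conical boundary point at which the field has a
limit, then the normal trace of this limit vanishes on the cone. -/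
lemma NormalTraceVanishesOn.sum_setIntegral_partialDeriv_smul_eq_zero {Ω Γ K U : Set Plane}
    (hΩ : IsOpen Ω) (hKo : IsOpen K)
    (hK : ∀ (t : ℝ) (x : Plane), 0 < t → (t • x ∈ K ↔ x ∈ K)) {h : ℝ} (hh : 0 < h)
    (hΩK : Ω ∩ Metric.ball 0 h = K ∩ Metric.ball 0 h) (hU : IsOpen U) (hU0 : (0 : Plane) ∈ U)
    (hΓ : Γ = U ∩ frontier Ω) {w W : Plane → Fin 2 → 𝕜} (hw : NormalTraceVanishesOn Ω Γ w)
    {w₀ : Fin 2 → 𝕜} (hwW : ∀ j, ∀ᵐ x : Plane, x ∈ K ∩ Metric.ball 0 h → w x j = W x j)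
    (hW : ∀ j, Tendsto (fun x => W x j) (𝓝[K ∩ Metric.ball 0 h] 0) (𝓝 (w₀ j)))
    {ψ : Plane → ℝ} (hψ : IsTestFunction ψ) :
    ∑ j, (∫ x in K, partialDeriv j ψ x) • w₀ j = 0 := by
  obtain ⟨f, hf, hvan⟩ := hw
  have hloc : ∀ j, LocallyIntegrable (fun x => w x j) (volume.restrict Ω) := fun j =>
    (hf.memLp j).locallyIntegrable (by norm_num)
  have hlocf : LocallyIntegrable f (volume.restrict Ω) :=
    hf.memLp_div.locallyIntegrable (by norm_num)
  have hlocS : ∀ j, LocallyIntegrable (fun x => w x j)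
      (volume.restrict (K ∩ Metric.ball 0 h)) := fun j =>
    ((hf.memLp j).mono_measure (Measure.restrict_mono_set _
      (hΩK ▸ inter_subset_left))).locallyIntegrable (by norm_num)
  -- This is Green's pairing with `ψ(x/ε)`, divided by `ε`: differentiating `ψ(x/ε)` produces the
  -- second factor `ε⁻¹` in the first term. For small `ε` the pairing is zero, so the limit is too.
  have L1 : Tendsto (fun ε : ℝ => (∑ j, (ε ^ 2)⁻¹ • ∫ x in K ∩ Metric.ball 0 h,
        partialDeriv j ψ (ε⁻¹ • x) • w x j) + ε⁻¹ • ∫ x in Ω, ψ (ε⁻¹ • x) • f x)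
      (𝓝[>] 0) (𝓝 ((∑ j, (∫ x in K, partialDeriv j ψ x) • w₀ j) + 0)) :=
    (tendsto_finsetSum _ fun j _ => tendsto_setIntegral_comp_inv_smul hKo hK hh
      (hψ.continuous_partialDeriv j) (hψ.hasCompactSupport_partialDeriv j) (hlocS j) (hwW j)
      (hW j)).add
      (tendsto_inv_smul_setIntegral_comp_inv_smul hf.memLp_div hψ.1.continuous hψ.2)
  rw [add_zero] at L1
  refine tendsto_nhds_unique L1 (tendsto_const_nhds.congr' ?_)
  filter_upwards [self_mem_nhdsWithin,
    eventually_tsupport_comp_inv_smul_subset hψ.2 (hU.mem_nhds hU0),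
    eventually_tsupport_comp_inv_smul_subset hψ.2 (Metric.ball_mem_nhds 0 hh)] with ε hε h1 h2
  have hε : 0 < ε := hε
  have hψε := hψ.comp_inv_smul hε
  have hzero := hvan _ hψε (by
    rw [hΓ]
    exact inter_subset_inter_left _ h1)
  have Ij : ∀ j, Integrable (fun x => partialDeriv j (fun x => ψ (ε⁻¹ • x)) x • w x j)
      (volume.restrict Ω) := fun j =>
    (hloc j).integrable_smul_left_of_hasCompactSupport (hψε.continuous_partialDeriv j)
      (hψε.hasCompactSupport_partialDeriv j)
  have If : Integrable (fun x => ψ (ε⁻¹ • x) • f x) (volume.restrict Ω) :=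
    hlocf.integrable_smul_left_of_hasCompactSupport hψε.1.continuous hψε.2
  rw [normalTracePairing, integral_add (integrable_finsetSum _ fun j _ => Ij j) If,
    integral_finsetSum _ fun j _ => Ij j] at hzero
  have hj : ∀ j, ∫ x in Ω, partialDeriv j (fun x => ψ (ε⁻¹ • x)) x • w x j
      = ε⁻¹ • ∫ x in K ∩ Metric.ball 0 h, partialDeriv j ψ (ε⁻¹ • x) • w x j := by
    intro j
    rw [← integral_smul, ← hΩK,
      setIntegral_eq_of_subset_of_forall_sdiff_eq_zero hΩ.measurableSet
        (inter_subset_left (t := Metric.ball 0 h))]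
    · simp_rw [partialDeriv_comp_smul, mul_smul]
    · intro x hx
      rw [image_eq_zero_of_notMem_tsupport fun hx' =>
        hx.2 ⟨hx.1, h2 (tsupport_partialDeriv_subset _ j hx')⟩, zero_smul]
  simp_rw [hj, ← Finset.smul_sum] at hzero
  have := congrArg (fun z => ε⁻¹ • z) hzero
  simp only [smul_add, smul_smul, smul_zero] at this
  rw [← this, ← Finset.smul_sum]
  congr 2
  ring

end BlowUp

/-! ### Algebra of the stress and facts about the corner. -/

section Corner

variable {𝕜 : Type*} [RCLike 𝕜]

lemma strain_apply (A : Matrix (Fin 2) (Fin 2) 𝕜) (i j : Fin 2) :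
    strain A i j = (A i j + A j i) / 2 := by
  simp only [strain, Matrix.smul_apply, Matrix.add_apply, Matrix.transpose_apply,
    RCLike.real_smul_eq_coe_mul]
  push_cast
  ring

lemma stress_apply (lam mu : ℝ) (A : Matrix (Fin 2) (Fin 2) 𝕜) (i j : Fin 2) :
    stress lam mu A i j
      = (lam : 𝕜) * (A 0 0 + A 1 1) * (if i = j then 1 else 0) + (mu : 𝕜) * (A i j + A j i) := by
  simp only [stress, strain_apply, Matrix.trace_fin_two, Matrix.add_apply, Matrix.smul_apply,
    Matrix.one_apply, RCLike.real_smul_eq_coe_mul, smul_eq_mul]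
  push_cast
  ring

lemma continuous_stress (lam mu : ℝ) :
    Continuous (stress lam mu : Matrix (Fin 2) (Fin 2) 𝕜 → _) := by
  refine continuous_matrix fun i j => ?_
  simp_rw [stress_apply]
  have h : ∀ k l : Fin 2, Continuous fun A : Matrix (Fin 2) (Fin 2) 𝕜 => A k l := fun k l =>
    continuous_id.matrix_elem k l
  exact ((continuous_const.mul ((h 0 0).add (h 1 1))).mul continuous_const).add
    (continuous_const.mul ((h i j).add (h j i)))

/-- A displacement gradient whose stress is the pressure `-p I`. -/
lemma strain_eq_smul_one_of_stress_add_eq_zero {lam mu : ℝ} (hmu : mu ≠ 0)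
    {A : Matrix (Fin 2) (Fin 2) 𝕜} {p : 𝕜}
    (h : ∀ i j, stress lam mu A i j + (if i = j then p else 0) = 0) :
    strain A = A 0 0 • (1 : Matrix (Fin 2) (Fin 2) 𝕜) ∧ p = (-2 * (lam + mu)) • A 0 0 := by
  have hmu' : (mu : 𝕜) ≠ 0 := RCLike.ofReal_ne_zero.2 hmu
  have h00 := h 0 0
  have h01 := h 0 1
  have h11 := h 1 1
  simp only [stress_apply, if_true, mul_one, zero_ne_one, if_false, mul_zero, zero_add,
    add_zero] at h00 h01 h11
  have hsym : A 0 1 + A 1 0 = 0 := (mul_eq_zero.1 h01).resolve_left hmu'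
  -- In the difference of the diagonal equations the trace and the pressure cancel, leaving `2 μ (A
  -- 1 1 - A 0 0) = 0`.
  have hdiag : A 1 1 = A 0 0 := by
    refine mul_left_cancel₀ hmu' (mul_left_cancel₀ (two_ne_zero (α := 𝕜)) ?_)
    linear_combination h11 - h00
  constructor
  · ext i j
    fin_cases i <;> fin_cases j <;> simp [strain_apply, hdiag, hsym, add_comm (A 1 0)]
  · rw [RCLike.real_smul_eq_coe_mul]
    push_cast
    rw [hdiag] at h00
    linear_combination h00

lemma openSector_isCone {θm θM : ℝ} (t : ℝ) (x : Plane) (ht : 0 < t) :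
    t • x ∈ openSector θm θM ↔ x ∈ openSector θm θM := by
  have key : ∀ (s : ℝ) (y : Plane), 0 < s → y ∈ openSector θm θM → s • y ∈ openSector θm θM := by
    rintro s y hs ⟨r, θ, hr, h1, h2, rfl⟩
    refine ⟨s * r, θ, mul_pos hs hr, h1, h2, ?_⟩
    ext i
    fin_cases i <;> simp [mul_assoc]
  refine ⟨fun h => ?_, key t x ht⟩
  simpa [smul_smul, ht.ne'] using key t⁻¹ (t • x) (inv_pos.2 ht) h

lemma zero_mem_closure_cornerRegion {Ω : Set Plane} (h0 : (0 : Plane) ∈ closure Ω) {h : ℝ}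
    (hh : 0 < h) : (0 : Plane) ∈ closure (cornerRegion Ω h) := by
  rw [cornerRegion, inter_comm]
  exact Metric.isOpen_ball.inter_closure ⟨Metric.mem_ball_self hh, h0⟩

lemma IsC1Holder.continuousOn_cornerGradient {S : Set Plane} {α : ℝ≥0} (hα : 0 < α)
    {u : Fin 2 → Plane → 𝕜} (hu : ∀ i, IsC1Holder S α (u i)) :
    ContinuousOn (cornerGradient S u) (closure S) := by
  refine continuousOn_pi.2 fun i => continuousOn_pi.2 fun j => ?_
  obtain ⟨C, hC⟩ := (hu i).2
  exact (hC.continuousOn hα).clm_apply continuousOn_const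

end Corner

/-! ### The blow-up applied to the traction condition. -/

theorem theorem2p1 {𝕜 : Type*} [RCLike 𝕜]
    (Ω Γ : Set Plane) (hΩ : IsBoundedLipschitzDomain Ω)
    -- a strictly convex corner at `0`
    (θm θM h : ℝ) (hcorner : HasStrictlyConvexCorner Ω θm θM h)
    -- `Γ` is a relatively open part of the boundary containing both sides of the corner
    (hΓ : ∃ U : Set Plane, IsOpen U ∧ Γ = U ∩ frontier Ω)
    (hsides : (halfLine θm ∪ halfLine θM) ∩ Metric.ball 0 h ⊆ Γ)
    -- the coefficients
    (lam mu rhoe rhob kappa omega : ℝ)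
    (hlame : 0 < 2 * lam + 2 * mu) (hmu : mu ≠ 0)
    (hrhoe : 0 < rhoe) (hrhob : 0 < rhob) (hkappa : 0 < kappa) (homega : 0 < omega)
    -- the eigenfunctions and their regularity near the corner
    (v : Plane → 𝕜) (u : Fin 2 → Plane → 𝕜)
    (heig : IsTransmissionEigenpair Ω Γ lam mu rhoe rhob kappa omega v u)
    (α₁ α₂ : ℝ≥0) (hα₁ : 0 < α₁ ∧ α₁ < 1) (hα₂ : 0 < α₂ ∧ α₂ < 1)
    (hu : ∀ i, IsC1Holder (cornerRegion Ω h) α₁ (u i))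
    (hv : ∃ C : ℝ≥0, HolderOnWith C α₂ v (closure (cornerRegion Ω h))) :
    -- (a)
    strain (cornerGradient (cornerRegion Ω h) u 0)
        = cornerGradient (cornerRegion Ω h) u 0 0 0 • (1 : Matrix (Fin 2) (Fin 2) 𝕜) ∧
    -- (b)
    v 0 = (-2 * (lam + mu)) • cornerGradient (cornerRegion Ω h) u 0 0 0 ∧
    -- (c)
    (cornerGradient (cornerRegion Ω h) u 0 0 0 = 0 → v 0 = 0) ∧
    -- (d)
    (cornerGradient (cornerRegion Ω h) u 0 0 0 = 0 →
      cornerGradient (cornerRegion Ω h) u 0 0 1 = 0 →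
        cornerGradient (cornerRegion Ω h) u 0 = 0) := by
  obtain ⟨Dv, Du, -, hDu, -, -, -, htraction⟩ := heig.weak_solution
  obtain ⟨U, hUo, hΓU⟩ := hΓ
  obtain ⟨C, hC⟩ := hv
  obtain ⟨L, hL⟩ := exists_openSector_eq_preimage_quadrant hcorner.lt hcorner.opening_lt_pi
  set S := cornerRegion Ω h with hS
  have hSK : S = openSector θm θM ∩ Metric.ball 0 h := hcorner.inter_ball
  have hSo : IsOpen S := hΩ.isOpen.inter Metric.isOpen_ball
  have hKo : IsOpen (openSector θm θM) := by
    rw [hL]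
    exact (isOpen_Ioi.prod isOpen_Ioi).preimage L.continuous
  -- The vertex is the point `r = 0` of a side. This puts `0` both in `U`, so that rescaled test
  -- functions are eventually admissible, and in the closure of `S`, so that limits at `0` within
  -- `S` are meaningful.
  have h0Γ : (0 : Plane) ∈ Γ := by
    refine hsides ⟨Or.inl ⟨0, le_rfl, ?_⟩, Metric.mem_ball_self hcorner.h_pos⟩
    ext i
    fin_cases i <;> simp
  rw [hΓU] at h0Γ
  have h0S : (0 : Plane) ∈ closure S :=
    zero_mem_closure_cornerRegion (frontier_subset_closure h0Γ.2) hcorner.h_pos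
  have hgrad : Tendsto (cornerGradient S u) (𝓝[S] 0) (𝓝 (cornerGradient S u 0)) :=
    (IsC1Holder.continuousOn_cornerGradient hα₁.1 hu 0 h0S).mono_left
      (nhdsWithin_mono _ subset_closure)
  have hvlim : Tendsto v (𝓝[S] 0) (𝓝 (v 0)) :=
    (hC.continuousOn hα₂.1 0 h0S).mono_left (nhdsWithin_mono _ subset_closure)
  have hae : ∀ᵐ x : Plane, x ∈ S → Du x = cornerGradient S u x := by
    have := fun i j => (hDu i).ae_eq_fderiv hSo inter_subset_left
      ((hu i).1.mono subset_closure) j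
    filter_upwards [this 0 0, this 0 1, this 1 0, this 1 1] with x h00 h01 h10 h11 hx
    have hnhds : closure S ∈ 𝓝 x := mem_of_superset (hSo.mem_nhds hx) subset_closure
    ext i j
    rw [cornerGradient, Matrix.of_apply, fderivWithin_of_mem_nhds hnhds]
    fin_cases i <;> fin_cases j
    exacts [h00 hx, h01 hx, h10 hx, h11 hx]
  have hzero : ∀ i, (fun j => stress lam mu (cornerGradient S u 0) i j
      + if i = j then v 0 else 0) = 0 := by
    intro i
    refine eq_zero_of_setIntegral_partialDeriv_quadrant L _ fun ψ hψ => ?_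
    rw [← hL]
    refine (htraction i).sum_setIntegral_partialDeriv_smul_eq_zero hΩ.isOpen hKo
      openSector_isCone hcorner.h_pos hcorner.inter_ball hUo h0Γ.1 hΓU
      -- The traction field is built from the weak gradient `Du`, fixed only almost everywhere; `W`
      -- is its classical representative, which has a limit at the vertex.
      (W := fun x j => stress lam mu (cornerGradient S u x) i j + if i = j then v x else 0)
      (fun j => ?_) (fun j => ?_) hψ
    · rw [← hSK]
      filter_upwards [hae] with x hx hxS
      rw [hx hxS]
    · rw [← hSK]
      have h1 := (((continuous_stress lam mu).matrix_elem i j).tendsto _).comp hgrad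
      refine h1.add ?_
      by_cases hij : i = j
      · simpa [hij] using hvlim
      · simpa only [hij, if_false] using tendsto_const_nhds
  obtain ⟨ha, hb⟩ := strain_eq_smul_one_of_stress_add_eq_zero hmu
    fun i j => congrFun (hzero i) j
  refine ⟨ha, hb, fun h00 => by rw [hb, h00, smul_zero], fun h00 h01 => ?_⟩
  -- The off-diagonal entry of (a) gives `∂₁u₂ = -∂₂u₁`, and the last diagonal entry gives `∂₂u₂ =
  -- ∂₁u₁`; both vanish here.
  have e10 := congrFun (congrFun ha 0) 1
  have e11 := congrFun (congrFun ha 1) 1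
  simp [strain_apply, h00, h01] at e10 e11
  ext i j
  fin_cases i <;> fin_cases j
  exacts [h00, h01, e10, by simpa using e11]
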